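/- Boxes are pairs $(i,j)$ of positive integers ($i$ = row, numbered from top to bottom; $j$ = column, numbered from left to right), and a Young diagram $Y=(Y_1\ge Y_2\ge\cdots)$ is identified with its set of boxes $\{(i,j): 1\le j\le Y_i\}$. For Young diagrams $Y,Z$, write $Z/Y$ for the set of boxes of $Z$ not in $Y$; a skew Young diagram is a set of boxes $N/M$ with $M\subseteq N$ Young diagrams. The number of boxes is denoted by $|\cdot|$. For boxes, $(a,b)\le_P(c,d)$ means $a\le c$ and $b\le d$. An admissible order on a finite set $X$ of boxes is a total order $\le_A$ on $X$ such that $(a,b)\le_A(c,d)$ whenever $a\le c$ and $b\ge d$. Given admissible orders $A$ on $X'$ and $A'$ on $X$, an $(A,A')$-admissible picture from $X$ to $X'$ is a bijection $f=(f_1,f_2):X\to X'$ such that $f(x)\le_A f(y)$ whenever $x\le_P y$ in $X$, and $f^{-1}(u)\le_{A'}f^{-1}(v)$ whenever $u\le_P v$ in $X'$; the set of these is $\mathbf P(X,X';A,A')$. Let $r\ge 0$ be an integer. For a skew Young diagram $W$ let $\mathbf B(W)$ be the set of fillings $T=(T_{ij})_{(i,j)\in W}$ of $W$ with entries in $\{1,\dots,r\}$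 that weakly increase along rows from left to right and strictly increase down columns. For a diagram $D$ (a finite set of boxes), let $D[j]$ be obtained by adding a box at the right end of row $j$, and let $D[j_1,\dots,j_k]=D[j_1,\dots,j_{k-1}][j_k]$. For Young diagrams $Y,Z$ and an admissible order $A'$ on $W$, let $\mathbf B(W)_Y^Z[A']$ be the set of all $T\in\mathbf B(W)$ such that, if $j_1,\dots,j_N$ are the entries of $T$ listed in $A'$-increasing order of their boxes, then $Y[j_1,\dots,j_k]$ is a Young diagram for every $k=1,\dots,N$, and $Y[j_1,\dots,j_N]=Z$. For $T\in\mathbf B(W)$ and $(i,j)\in W$, let $p(T;i,j)$ be the number of boxes $(i',j')\in W$ with $T_{i'j'}=T_{ij}$ and $j'\ge j$. **Theorem.** Let $Y,Z$ be Young diagrams with at most $r$ rows and let $W$ be a skew Young diagram with $|Y|+|W|=|Z|$. Let $A$ and $A'$ be arbitrary admissible orders on $Z/Y$ and on $W$, respectively. Then $$\Phi(f)_{ij}=f_1(i,j),\qquad \Psi(T)(i,j)=\bigl(T_{ij},\,Y_{T_{ij}}+p(T;i,j)\bigr)\qquad((i,j)\in W)$$ define maps $\Phi:\mathbf P(W,Z/Y;A,A')\to\mathbf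 B(W)_Y^Z[A']$ and $\Psi:\mathbf B(W)_Y^Z[A']\to\mathbf P(W,Z/Y;A,A')$, which are bijections inverse to each other. -/

import Mathlib

namespace LRPictures

/-- A box in row `i` and column `j`, written `(i, j)`; rows and columns are numbered from `1`. -/
abbrev Box : Type := ℕ × ℕ

/-- The set of boxes `(i, j)`, with `i, j ≥ 1`, of a Young diagram.
(Mathlib numbers rows and columns of `YoungDiagram` from `0`.) -/
def boxes (Y : YoungDiagram) : Finset Box :=
  Y.cells.image fun c => (c.1 + 1, c.2 + 1)

/-- A finite set of boxes is a Young diagram. -/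
def IsYoung (D : Finset Box) : Prop :=
  ∃ Y : YoungDiagram, boxes Y = D

/-- The boxes of `Z` that do not lie in `Y`; for `Y ⊆ Z` this is the skew diagram `Z / Y`. -/
def skewBoxes (Z Y : YoungDiagram) : Finset Box :=
  boxes Z \ boxes Y

/-- `W` is a skew Young diagram: `W = N / M` for Young diagrams `M ⊆ N`. -/
def IsSkewDiagram (W : Finset Box) : Prop :=
  ∃ N M : YoungDiagram, M ≤ N ∧ W = skewBoxes N M

/-- The number of boxes in row `i` of a diagram `D`; for a Young diagram `Y` it is `Y_i`. -/
def rowLength (D : Finset Box) (i : ℕ) : ℕ :=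
  (D.filter fun x => x.1 = i).card

/-- The order `≤_P`: `(a, b) ≤_P (c, d)` iff `a ≤ c` and `b ≤ d`. -/
def LeP (x y : Box) : Prop :=
  x.1 ≤ y.1 ∧ x.2 ≤ y.2

/-- An admissible order on `X`: a total order on `X` with `(a, b) ≤_A (c, d)` whenever
`a ≤ c` and `b ≥ d`. -/
structure AdmissibleOrder (X : Finset Box) where
  le : X → X → Prop
  isLinearOrder : IsLinearOrder X le
  admissible : ∀ x y : X, x.1.1 ≤ y.1.1 → y.1.2 ≤ x.1.2 → le x y

/-- `f : X → Y` is `PA`-standard, for an admissible order `A` on `Y`. -/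
def IsStandard {X Y : Finset Box} (A : AdmissibleOrder Y) (f : X → Y) : Prop :=
  ∀ x y : X, LeP x.1 y.1 → A.le (f x) (f y)

/-- The set of `(A, A')`-admissible pictures from `X` to `Y`. -/
def pictures (X Y : Finset Box) (A : AdmissibleOrder Y) (A' : AdmissibleOrder X) :
    Set (X ≃ Y) :=
  {f | IsStandard A f ∧ IsStandard A' f.symm}

/-- A filling of `W` is semistandard: weakly increasing along rows from left to right and
strictly increasing down columns. -/
def IsSemistandard {W : Finset Box} (T : W → ℕ) : Prop :=
  (∀ x y : W, x.1.1 = y.1.1 → x.1.2 < y.1.2 → T x ≤ T y) ∧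
    ∀ x y : W, x.1.2 = y.1.2 → x.1.1 < y.1.1 → T x < T y

/-- The set `B(W)` of semistandard tableaux of shape `W` with entries in `{1, …, r}`. -/
def tableaux (r : ℕ) (W : Finset Box) : Set (W → ℕ) :=
  {T | IsSemistandard T ∧ ∀ x, 1 ≤ T x ∧ T x ≤ r}

/-- The boxes of `W`, listed in increasing order for `A`. -/
noncomputable def AdmissibleOrder.boxList {W : Finset Box} (A : AdmissibleOrder W) : List W :=
  haveI := A.isLinearOrder
  haveI : DecidableRel A.le := Classical.decRel _
  Finset.univ.sort A.le

/-- The admissible reading of `T` by `A`: the entries of `T` listed in the order `A`. -/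
noncomputable def reading {W : Finset Box} (A : AdmissibleOrder W) (T : W → ℕ) : List ℕ :=
  A.boxList.map T

/-- `D[j]`: add a box at the (right) end of the `j`-th row of `D`. -/
def addBox (D : Finset Box) (j : ℕ) : Finset Box :=
  insert (j, rowLength D j + 1) D

/-- `D[j₁, …, j_N]`: add boxes successively at rows `j₁, …, j_N`. -/
def addBoxes (D : Finset Box) (js : List ℕ) : Finset Box :=
  js.foldl addBox D

/-- The set `B(W)_Y^Z[A]` of Littlewood–Richardson (skew) tableaux: those `T ∈ B(W)` with
`A`-reading `j₁, …, j_N` such that `Y[j₁, …, j_k]` is a Young diagram for `k = 1, …, N` and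
`Y[j₁, …, j_N] = Z`. -/
def lrTableaux (r : ℕ) (W : Finset Box) (Y Z : YoungDiagram) (A : AdmissibleOrder W) :
    Set (W → ℕ) :=
  {T | T ∈ tableaux r W ∧
    (∀ k, 1 ≤ k → k ≤ (reading A T).length →
      IsYoung (addBoxes (boxes Y) ((reading A T).take k))) ∧
    addBoxes (boxes Y) (reading A T) = boxes Z}

/-- `p(T; i, j)`: the number of boxes with the same entry as `x = (i, j)` that lie to the right
of `x`, including `x` itself. -/
def position {W : Finset Box} (T : W → ℕ) (x : W) : ℕ :=
  (Finset.univ.filter fun y : W => T y = T x ∧ x.1.2 ≤ y.1.2).card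

end LRPictures

/-!
Let `≤_J` be the order "weakly north-east", which every admissible order contains. The proof rests
on the fact that a picture is monotone from `≤_P` to `≤_J` in both directions (`leJ_of_le`),
whatever the admissible orders are. If this fails for neighbours in `W`, their images are strictly comparable
for `≤_P`; the south-west corner of the rectangle they span has a preimage further to the south-east
in `W`, and monotonicity there, known by induction, leads to a contradiction.

It follows at once that the rows of a picture `f` form a semistandard tableau `T`, that equal entries
of `T` are mapped from right to left onto a row of `Z / Y`, so that `f` is recovered from `T`
(`col_eq_of_isStandard_symm`), and that the initial segments of `A'` give order ideals of `Z / Y`.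

In a semistandard tableau the boxes with equal entries form a chain for `≤_J`, so every admissible
reading visits them from right to left, and the box added at the step of `x` is the one given by the
formula for `Ψ` (`addBoxes_map_of_prefix`). Thus the Littlewood–Richardson condition says
exactly that `Ψ T` is a bijection with standard inverse. That `Ψ T` itself is standard
(`isStandard_of_isSemistandard`) is clear along rows; a violation in a column, by the
semistandardness of `T`, yields another violation in a column further to the left.
-/

namespace LRPictures

/-! ### Boxes of Young diagrams and of skew diagrams -/

theorem mem_boxes {Y : YoungDiagram} {x : Box} :
    x ∈ boxes Y ↔ 1 ≤ x.1 ∧ 1 ≤ x.2 ∧ (x.1 - 1, x.2 - 1) ∈ Y := by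
  obtain ⟨a, b⟩ := x
  simp only [boxes, Finset.mem_image, YoungDiagram.mem_cells, Prod.mk.injEq, Prod.exists]
  constructor
  · rintro ⟨i, j, h, rfl, rfl⟩
    simpa using h
  · rintro ⟨ha, hb, h⟩
    exact ⟨_, _, h, by omega, by omega⟩

theorem card_boxes (Y : YoungDiagram) : (boxes Y).card = Y.card :=
  Finset.card_image_of_injective _ fun a b h => by
    simp only [Prod.mk.injEq, add_left_inj] at h
    exact Prod.ext h.1 h.2

theorem one_le_of_mem_boxes {Y : YoungDiagram} {x : Box} (h : x ∈ boxes Y) :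
    1 ≤ x.1 ∧ 1 ≤ x.2 :=
  ⟨(mem_boxes.1 h).1, (mem_boxes.1 h).2.1⟩

theorem mem_boxes_of_le {Y : YoungDiagram} {x y : Box} (hy : y ∈ boxes Y) (h : x ≤ y)
    (h1 : 1 ≤ x.1) (h2 : 1 ≤ x.2) : x ∈ boxes Y :=
  mem_boxes.2 ⟨h1, h2, Y.up_left_mem (Nat.sub_le_sub_right h.1 1) (Nat.sub_le_sub_right h.2 1)
    (mem_boxes.1 hy).2.2⟩

theorem isYoung_iff {D : Finset Box} :
    IsYoung D ↔ (∀ x ∈ D, 1 ≤ x.1 ∧ 1 ≤ x.2) ∧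
      ∀ x y : Box, y ∈ D → x ≤ y → 1 ≤ x.1 → 1 ≤ x.2 → x ∈ D := by
  constructor
  · rintro ⟨Y, rfl⟩
    exact ⟨fun x => one_le_of_mem_boxes, fun x y => mem_boxes_of_le⟩
  · rintro ⟨h1, h2⟩
    have key : ∀ i j, (i, j) ∈ D.image (fun x => (x.1 - 1, x.2 - 1)) ↔ (i + 1, j + 1) ∈ D := by
      intro i j
      simp only [Finset.mem_image, Prod.mk.injEq, Prod.exists]
      constructor
      · rintro ⟨a, b, h, rfl, rfl⟩
        have := h1 _ h
        simpa [Nat.sub_add_cancel this.1, Nat.sub_add_cancel this.2] using h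
      · intro h
        exact ⟨_, _, h, rfl, rfl⟩
    refine ⟨⟨D.image fun x => (x.1 - 1, x.2 - 1), ?_⟩, ?_⟩
    · rintro ⟨a, b⟩ ⟨c, d⟩ hle h
      simp only [Finset.mem_coe, key] at h ⊢
      exact h2 _ _ h ⟨Nat.succ_le_succ hle.1, Nat.succ_le_succ hle.2⟩ (by simp) (by simp)
    · ext ⟨a, b⟩
      rw [mem_boxes, ← YoungDiagram.mem_cells]
      simp only [key]
      constructor
      · rintro ⟨ha, hb, h⟩
        simpa [Nat.sub_add_cancel ha, Nat.sub_add_cancel hb] using h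
      · intro h
        have := h1 _ h
        exact ⟨this.1, this.2,
          by simpa [Nat.sub_add_cancel this.1, Nat.sub_add_cancel this.2] using h⟩

theorem mem_boxes_iff_le_rowLength {Y : YoungDiagram} {c d : ℕ} (hc : 1 ≤ c) (hd : 1 ≤ d) :
    (c, d) ∈ boxes Y ↔ d ≤ rowLength (boxes Y) c := by
  have h : (boxes Y).filter (fun x => x.1 = c) =
      (Finset.Icc 1 (Y.rowLen (c - 1))).image fun d => (c, d) := by
    ext ⟨a, b⟩
    simp only [Finset.mem_filter, mem_boxes, YoungDiagram.mem_iff_lt_rowLen, Finset.mem_image,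
      Finset.mem_Icc, Prod.mk.injEq]
    constructor
    · rintro ⟨⟨_, hb, h⟩, rfl⟩
      exact ⟨b, by omega, rfl, rfl⟩
    · rintro ⟨b', h, rfl, rfl⟩
      exact ⟨⟨hc, by omega, by omega⟩, rfl⟩
  rw [rowLength, h, Finset.card_image_of_injective _ (fun _ _ h => (Prod.mk.inj h).2),
    Nat.card_Icc, mem_boxes, YoungDiagram.mem_iff_lt_rowLen]
  dsimp only
  omega

theorem mem_skewBoxes {Z Y : YoungDiagram} {x : Box} :
    x ∈ skewBoxes Z Y ↔ x ∈ boxes Z ∧ x ∉ boxes Y :=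
  Finset.mem_sdiff

theorem ordConnected_skewBoxes (Z Y : YoungDiagram) :
    (skewBoxes Z Y : Set Box).OrdConnected := by
  refine ⟨fun x hx z hz y hy => ?_⟩
  rw [Finset.mem_coe, mem_skewBoxes] at hx hz ⊢
  have h := one_le_of_mem_boxes hx.1
  have h1 := h.1.trans hy.1.1
  have h2 := h.2.trans hy.1.2
  exact ⟨mem_boxes_of_le hz.1 hy.2 h1 h2, fun hY => hx.2 (mem_boxes_of_le hY hy.1 h.1 h.2)⟩

theorem IsSkewDiagram.ordConnected {W : Finset Box} (hW : IsSkewDiagram W) :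
    (W : Set Box).OrdConnected := by
  obtain ⟨N, M, -, rfl⟩ := hW
  exact ordConnected_skewBoxes N M

/-! ### The order common to all admissible orders -/

/-- The partial order `≤_J`: `x ≤_J y` iff `x` lies weakly to the north-east of `y`. By definition
every admissible order contains it. -/
def LeJ (x y : Box) : Prop :=
  x.1 ≤ y.1 ∧ y.2 ≤ x.2

namespace AdmissibleOrder

variable {X : Finset Box} (A : AdmissibleOrder X)

theorem le_of_leJ {x y : X} (h : LeJ x.1 y.1) : A.le x y :=
  A.admissible x y h.1 h.2

theorem refl (x : X) : A.le x x :=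
  A.le_of_leJ ⟨le_rfl, le_rfl⟩

theorem antisymm {x y : X} (h : A.le x y) (h' : A.le y x) : x = y :=
  A.isLinearOrder.antisymm x y h h'

theorem trans {x y z : X} (h : A.le x y) (h' : A.le y z) : A.le x z :=
  A.isLinearOrder.trans x y z h h'

end AdmissibleOrder

/-! ### Pictures are monotone from `≤_P` to `≤_J` -/

section Rigidity

variable {X X' : Finset Box} {A : AdmissibleOrder X'} {A' : AdmissibleOrder X}

/-- If `f⁻¹` is standard, then `f x ≤_P f y` is incompatible with `y <_J x`. -/
theorem eq_of_le_of_leJ {f : X ≃ X'} (hf : IsStandard A' f.symm) {x y : X}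
    (h : (f x).1 ≤ (f y).1) (h' : LeJ y.1 x.1) : x = y := by
  have := hf (f x) (f y) h
  rw [f.symm_apply_apply, f.symm_apply_apply] at this
  exact A'.antisymm this (A'.le_of_leJ h')

/-- If `f` is standard, then `x ≤_P y` is incompatible with `f y <_J f x`. -/
theorem eq_of_leJ_of_le {f : X ≃ X'} (hf : IsStandard A f) {x y : X}
    (h : x.1 ≤ y.1) (h' : LeJ (f y).1 (f x).1) : x = y :=
  f.injective (A.antisymm (hf x y h) (A.le_of_leJ h'))

/-- If `f p` lies strictly north-west of `f q`, then the corner south-west of both is the image of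
a box `z`. It is not `≤_P` either of them, and as it lies strictly between `p` and `q` for
`≤_{A'}`, neither `z ≤_J p` nor `q ≤_J z` holds. -/
theorem exists_preimage_corner {f : X ≃ X'} (hX' : (X' : Set Box).OrdConnected)
    (hf : IsStandard A f) (hf' : IsStandard A' f.symm) {p q : X}
    (h1 : (f p).1.1 < (f q).1.1) (h2 : (f p).1.2 < (f q).1.2) :
    ∃ z : X, (f z).1 = ((f q).1.1, (f p).1.2) ∧ ¬ z.1 ≤ p.1 ∧ ¬ z.1 ≤ q.1 ∧
      ¬ LeJ z.1 p.1 ∧ ¬ LeJ q.1 z.1 := by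
  have hu : ((f q).1.1, (f p).1.2) ∈ X' :=
    hX'.out (f p).2 (f q).2 ⟨⟨h1.le, le_rfl⟩, ⟨le_rfl, h2.le⟩⟩
  obtain ⟨z, hz⟩ : ∃ z, (f z).1 = ((f q).1.1, (f p).1.2) := ⟨f.symm ⟨_, hu⟩, by simp⟩
  have hzp : z ≠ p := by
    rintro rfl
    exact h1.ne (Prod.ext_iff.1 hz).1
  have hzq : z ≠ q := by
    rintro rfl
    exact h2.ne' (Prod.ext_iff.1 hz).2
  refine ⟨z, hz, fun h => hzp (eq_of_leJ_of_le hf h ?_), fun h => hzq (eq_of_leJ_of_le hf h ?_),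
    fun h => hzp.symm (eq_of_le_of_leJ hf' ?_ h), fun h => hzq (eq_of_le_of_leJ hf' ?_ h)⟩ <;>
  rw [hz]
  · exact ⟨h1.le, le_rfl⟩
  · exact ⟨le_rfl, h2.le⟩
  · exact ⟨h1.le, le_rfl⟩
  · exact ⟨le_rfl, h2.le⟩

/-- A standard bijection of convex sets of boxes with standard inverse is monotone from `≤_P` to
`≤_J`, so it is standard for every admissible order on its target. -/
theorem leJ_of_le {f : X ≃ X'} (hX : (X : Set Box).OrdConnected)
    (hX' : (X' : Set Box).OrdConnected) (hf : IsStandard A f) (hf' : IsStandard A' f.symm)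
    (x y : X) (hxy : x.1 ≤ y.1) : LeJ (f x).1 (f y).1 := by
  -- Induction on `x`, from the south-east of `X` towards the north-west.
  induction x using WellFoundedGT.induction generalizing y with
  | ind x ih =>
  have lt_right (z w : X) (h : w.1 = (z.1.1, z.1.2 + 1)) : z < w := by
    refine lt_of_le_of_ne (show z.1 ≤ w.1 by rw [h]; exact ⟨le_rfl, Nat.le_succ _⟩) ?_
    rintro rfl
    simpa using congrArg Prod.snd h
  have lt_down (z w : X) (h : w.1 = (z.1.1 + 1, z.1.2)) : z < w := by
    refine lt_of_le_of_ne (show z.1 ≤ w.1 by rw [h]; exact ⟨Nat.le_succ _, le_rfl⟩) ?_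
    rintro rfl
    simpa using congrArg Prod.fst h
  -- The step from `x = (i, j)` to its right neighbour `w`. If it fails, `f w` lies strictly
  -- north-west of `f x`, and the preimage `z` of the corner south-west of both satisfies
  -- `(i + 1, j + 1) ≤_P z`. So the box `d` below `x` lies in `X`, and monotonicity between `d` and
  -- `z`, known by induction, leaves no place for `f d`.
  have right (w : X) (hw : w.1 = (x.1.1, x.1.2 + 1)) : LeJ (f x).1 (f w).1 := by
    by_contra hbad
    have hne := (lt_right x w hw).ne
    have h1 : ¬ LeJ (f w).1 (f x).1 :=
      fun h => hne (eq_of_leJ_of_le hf (lt_right x w hw).le h)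
    have h2 : ¬ (f x).1 ≤ (f w).1 :=
      fun h => hne (eq_of_le_of_leJ hf' h (by rw [hw]; exact ⟨le_rfl, Nat.le_succ _⟩))
    simp only [LeJ, Prod.le_def] at hbad h1 h2
    obtain ⟨z, hz, hzw, hzx, hzw', hzx'⟩ :=
      exists_preimage_corner hX' hf hf' (p := w) (q := x) (by omega) (by omega)
    simp only [LeJ, Prod.le_def, hw] at hzx hzw hzx' hzw'
    have hd : (x.1.1 + 1, x.1.2) ∈ X := hX.out x.2 z.2
      ⟨by constructor <;> dsimp only <;> omega, by constructor <;> dsimp only <;> omega⟩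
    have hxd := lt_down x ⟨_, hd⟩ rfl
    have hdz := ih ⟨_, hd⟩ hxd z (by constructor <;> dsimp only <;> omega)
    have h3 : ¬ (f ⟨_, hd⟩).1 ≤ (f x).1 := fun h =>
      hxd.ne' (eq_of_le_of_leJ hf' h (by constructor <;> dsimp only <;> omega))
    have h4 : ¬ LeJ (f ⟨_, hd⟩).1 (f x).1 := fun h => hxd.ne (eq_of_leJ_of_le hf hxd.le h)
    rw [hz] at hdz
    simp only [LeJ, Prod.le_def] at hdz h3 h4
    omega
  -- The step to the lower neighbour, with the box `r` to the right of `x` in the role of `d`.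
  have down (w : X) (hw : w.1 = (x.1.1 + 1, x.1.2)) : LeJ (f x).1 (f w).1 := by
    by_contra hbad
    have hne := (lt_down x w hw).ne
    have h1 : ¬ LeJ (f w).1 (f x).1 :=
      fun h => hne (eq_of_leJ_of_le hf (lt_down x w hw).le h)
    have h2 : ¬ (f w).1 ≤ (f x).1 :=
      fun h => hne (eq_of_le_of_leJ hf' h (by rw [hw]; exact ⟨Nat.le_succ _, le_rfl⟩)).symm
    simp only [LeJ, Prod.le_def] at hbad h1 h2
    obtain ⟨z, hz, hzx, hzw, hzx', hzw'⟩ :=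
      exists_preimage_corner hX' hf hf' (p := x) (q := w) (by omega) (by omega)
    simp only [LeJ, Prod.le_def, hw] at hzx hzw hzx' hzw'
    have hr : (x.1.1, x.1.2 + 1) ∈ X := hX.out x.2 z.2
      ⟨by constructor <;> dsimp only <;> omega, by constructor <;> dsimp only <;> omega⟩
    have hxr := lt_right x ⟨_, hr⟩ rfl
    have hrz := ih ⟨_, hr⟩ hxr z (by constructor <;> dsimp only <;> omega)
    have h3 : ¬ (f x).1 ≤ (f ⟨_, hr⟩).1 := fun h =>
      hxr.ne (eq_of_le_of_leJ hf' h (by constructor <;> dsimp only <;> omega))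
    have h4 : ¬ LeJ (f ⟨_, hr⟩).1 (f x).1 := fun h => hxr.ne (eq_of_leJ_of_le hf hxr.le h)
    rw [hz] at hrz
    simp only [LeJ, Prod.le_def] at hrz h3 h4
    omega
  have step (w : X) (hxw : x < w) (hwy : w.1 ≤ y.1) (h : LeJ (f x).1 (f w).1) :
      LeJ (f x).1 (f y).1 :=
    have h' := ih w hxw y hwy
    ⟨h.1.trans h'.1, h'.2.trans h.2⟩
  have hxy1 := hxy.1
  have hxy2 := hxy.2
  by_cases hr : x.1.2 < y.1.2
  · have hmem : (x.1.1, x.1.2 + 1) ∈ X :=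
      hX.out x.2 y.2 ⟨⟨le_rfl, Nat.le_succ _⟩, ⟨hxy1, hr⟩⟩
    exact step ⟨_, hmem⟩ (lt_right x ⟨_, hmem⟩ rfl) ⟨hxy1, hr⟩ (right _ rfl)
  by_cases hd : x.1.1 < y.1.1
  · have hmem : (x.1.1 + 1, x.1.2) ∈ X :=
      hX.out x.2 y.2 ⟨⟨Nat.le_succ _, le_rfl⟩, ⟨hd, hxy2⟩⟩
    exact step ⟨_, hmem⟩ (lt_down x ⟨_, hmem⟩ rfl) ⟨hd, hxy2⟩ (down _ rfl)
  have : x = y := Subtype.ext (Prod.ext (by omega) (by omega))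
  rw [this]
  exact ⟨le_rfl, le_rfl⟩

end Rigidity

/-! ### Semistandard tableaux and the rows of bijections -/

section Semistandard

variable {W : Finset Box} {T : W → ℕ}

theorem IsSemistandard.le_and_lt (hT : IsSemistandard T) (hW : (W : Set Box).OrdConnected)
    {x y : W} (h : x.1 ≤ y.1) : T x ≤ T y ∧ (x.1.1 < y.1.1 → T x < T y) := by
  -- Go from `x` along its row to the column of `y`, then down that column.
  have hw : (x.1.1, y.1.2) ∈ W := hW.out x.2 y.2 ⟨⟨le_rfl, h.2⟩, ⟨h.1, le_rfl⟩⟩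
  have h1 : T x ≤ T ⟨_, hw⟩ := by
    rcases h.2.eq_or_lt with h2 | h2
    · have : x = ⟨_, hw⟩ := Subtype.ext (Prod.ext rfl h2)
      exact (congrArg T this).le
    · exact hT.1 x ⟨_, hw⟩ rfl h2
  rcases h.1.eq_or_lt with h2 | h2
  · have : (⟨_, hw⟩ : W) = y := Subtype.ext (Prod.ext h2 rfl)
    rw [this] at h1
    exact ⟨h1, fun h => absurd h2 h.ne⟩
  · have h3 := h1.trans_lt (hT.2 ⟨_, hw⟩ y rfl h2)
    exact ⟨h3.le, fun _ => h3⟩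

theorem IsSemistandard.eq_of_col_eq (hT : IsSemistandard T) {x y : W} (h : T x = T y)
    (hxy : x.1.2 = y.1.2) : x = y := by
  rcases lt_trichotomy x.1.1 y.1.1 with h1 | h1 | h1
  · exact absurd h (hT.2 x y hxy h1).ne
  · exact Subtype.ext (Prod.ext h1 hxy)
  · exact absurd h (hT.2 y x hxy.symm h1).ne'

/-- The boxes with a given entry form a chain for `≤_J`. -/
theorem IsSemistandard.leJ_of_eq (hT : IsSemistandard T) (hW : (W : Set Box).OrdConnected)
    {x y : W} (h : T x = T y) (hxy : y.1.2 ≤ x.1.2) : LeJ x.1 y.1 := by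
  refine ⟨?_, hxy⟩
  by_contra! h1
  exact ((hT.le_and_lt hW ⟨h1.le, hxy⟩).2 h1).ne' h

/-- All admissible orders agree on the boxes with a given entry. -/
theorem IsSemistandard.le_iff_of_eq (hT : IsSemistandard T) (hW : (W : Set Box).OrdConnected)
    (A : AdmissibleOrder W) {x y : W} (h : T x = T y) : A.le x y ↔ y.1.2 ≤ x.1.2 := by
  refine ⟨fun hA => ?_, fun hxy => A.le_of_leJ (hT.leJ_of_eq hW h hxy)⟩
  by_contra! h1
  have := A.antisymm hA (A.le_of_leJ (hT.leJ_of_eq hW h.symm h1.le))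
  exact h1.ne (by rw [this])

theorem position_pos (T : W → ℕ) (x : W) : 1 ≤ position T x :=
  Finset.card_pos.2 ⟨x, by simp⟩

theorem position_lt {x y : W} (h : T x = T y) (hxy : x.1.2 < y.1.2) :
    position T y < position T x := by
  refine Finset.card_lt_card (Finset.ssubset_iff_of_subset ?_ |>.2 ⟨x, ?_, ?_⟩)
  · intro z
    simp only [Finset.mem_filter, Finset.mem_univ, true_and]
    exact fun hz => ⟨hz.1.trans h.symm, hxy.le.trans hz.2⟩
  · simp
  · simp [hxy]

end Semistandard

section Bijection

variable {W X : Finset Box} {A : AdmissibleOrder X} {A' : AdmissibleOrder W}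

/-- The rows of the images under a picture form a semistandard tableau. -/
theorem isSemistandard_of_isStandard {f : W ≃ X} (hW : (W : Set Box).OrdConnected)
    (hX : (X : Set Box).OrdConnected) (hf : IsStandard A f) (hf' : IsStandard A' f.symm) :
    IsSemistandard fun x => (f x).1.1 := by
  refine ⟨fun x y h1 h2 => (leJ_of_le hW hX hf hf' x y ⟨h1.le, h2.le⟩).1, fun x y h1 h2 => ?_⟩
  have h := leJ_of_le hW hX hf hf' x y ⟨h2.le, h1.le⟩
  refine h.1.lt_of_ne fun he => ?_
  -- Otherwise `f y ≤_P f x`, and the monotonicity of `f⁻¹` gives `y ≤_J x`.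
  have := (leJ_of_le hX hW hf' (f := f.symm) (A' := A) hf (f y) (f x) ⟨he.ge, h.2⟩).1
  simp only [Equiv.symm_apply_apply] at this
  omega

/-- A bijection with standard inverse whose rows form a semistandard tableau is standard for
every admissible order, since it is monotone from `≤_P` to `≤_J`. -/
theorem isStandard_of_isSemistandard {f : W ≃ X} (hW : (W : Set Box).OrdConnected)
    (hX : (X : Set Box).OrdConnected) (hf' : IsStandard A' f.symm)
    (hT : IsSemistandard fun x => (f x).1.1) (A : AdmissibleOrder X) : IsStandard A f := by
  have row (x y : W) (h1 : x.1.1 = y.1.1) (h2 : x.1.2 ≤ y.1.2) : (f y).1.2 ≤ (f x).1.2 := by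
    by_contra! h
    have := eq_of_le_of_leJ hf' (x := x) (y := y)
      ⟨(hT.le_and_lt hW ⟨h1.le, h2⟩).1, h.le⟩ ⟨h1.ge, h2⟩
    exact h.ne (by rw [this])
  -- A column pair violating the claim produces another one further to the left.
  have col (n : ℕ) : ∀ x y : W, x.1.2 = n → y.1.2 = n → x.1.1 < y.1.1 →
      (f y).1.2 ≤ (f x).1.2 := by
    induction n using Nat.strong_induction_on with
    | _ n ih =>
    intro x y hx hy hlt
    by_contra! h
    have hTxy : (f x).1.1 < (f y).1.1 := hT.2 x y (hx.trans hy.symm) hlt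
    have hu : ((f x).1.1, (f y).1.2) ∈ X :=
      hX.out (f x).2 (f y).2 ⟨⟨le_rfl, h.le⟩, ⟨hTxy.le, le_rfl⟩⟩
    obtain ⟨z, hz⟩ : ∃ z, (f z).1 = ((f x).1.1, (f y).1.2) := ⟨f.symm ⟨_, hu⟩, by simp⟩
    have hz1 : (f z).1.1 = (f x).1.1 := by rw [hz]
    have hz2 : (f z).1.2 = (f y).1.2 := by rw [hz]
    have hzx : z ≠ x := by
      rintro rfl
      exact h.ne hz2
    have hxz : ¬ LeJ z.1 x.1 := fun h' => hzx.symm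
      (eq_of_le_of_leJ hf' ⟨hz1.ge, by rw [hz2]; exact h.le⟩ h')
    have hzl : z.1.2 < x.1.2 := by
      by_contra! h'
      exact hxz (hT.leJ_of_eq hW hz1 h')
    have hzx1 : x.1.1 ≤ z.1.1 := (hT.leJ_of_eq hW hz1.symm hzl.le).1
    have hzy : z.1.1 < y.1.1 := by
      by_contra! h'
      have := eq_of_le_of_leJ hf' (x := z) (y := y)
        ⟨by rw [hz1]; exact hTxy.le, hz2.le⟩ ⟨h', by omega⟩
      exact hTxy.ne (by rw [← this, hz1])
    have hw : (y.1.1, z.1.2) ∈ W :=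
      hW.out z.2 y.2 ⟨⟨hzy.le, le_rfl⟩, ⟨le_rfl, by dsimp only; omega⟩⟩
    have h1 : (f ⟨_, hw⟩).1.2 ≤ (f z).1.2 := ih _ (by omega) z ⟨_, hw⟩ rfl rfl hzy
    have h2 : (f ⟨_, hw⟩).1.1 ≤ (f y).1.1 :=
      (hT.le_and_lt hW (x := ⟨_, hw⟩) (y := y) ⟨le_rfl, by dsimp only; omega⟩).1
    have := eq_of_le_of_leJ hf' (x := ⟨_, hw⟩) (y := y) ⟨h2, h1.trans hz2.le⟩
      ⟨le_rfl, by dsimp only; omega⟩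
    have := congrArg (fun x : W => x.1.2) this
    dsimp only at this
    omega
  intro x y h
  have hw : (x.1.1, y.1.2) ∈ W := hW.out x.2 y.2 ⟨⟨le_rfl, h.2⟩, ⟨h.1, le_rfl⟩⟩
  refine A.le_of_leJ ⟨(hT.le_and_lt hW h).1, ?_⟩
  refine le_trans ?_ (row x ⟨_, hw⟩ rfl h.2)
  rcases h.1.eq_or_lt with h2 | h2
  · exact row ⟨_, hw⟩ y h2 le_rfl
  · exact col _ ⟨_, hw⟩ y rfl rfl h2

/-- If `f⁻¹` is standard and the rows of `f` form a semistandard tableau, then the boxes with the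
same entry as `x` are mapped to one row of `Z / Y` in reversed order of their columns; hence
`position` gives the column of `f x`. -/
theorem col_eq_of_isStandard_symm {Y Z : YoungDiagram} {A' : AdmissibleOrder W}
    {f : W ≃ skewBoxes Z Y} (hW : (W : Set Box).OrdConnected) (hf' : IsStandard A' f.symm)
    (hT : IsSemistandard fun x => (f x).1.1) (x : W) :
    (f x).1.2 = rowLength (boxes Y) (f x).1.1 + position (fun x => (f x).1.1) x := by
  have hS (z : skewBoxes Z Y) : 1 ≤ z.1.1 ∧ 1 ≤ z.1.2 ∧ rowLength (boxes Y) z.1.1 < z.1.2 := by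
    have h := mem_skewBoxes.1 z.2
    have h1 := one_le_of_mem_boxes h.1
    refine ⟨h1.1, h1.2, ?_⟩
    by_contra! h2
    exact h.2 ((mem_boxes_iff_le_rowLength h1.1 h1.2).2 h2)
  have key (y : W) (h : (f y).1.1 = (f x).1.1) : (f y).1.2 ≤ (f x).1.2 ↔ x.1.2 ≤ y.1.2 := by
    rw [← hT.le_iff_of_eq hW A' h]
    have mono (a b : W) (hab : (f a).1.1 = (f b).1.1) (h2 : (f a).1.2 ≤ (f b).1.2) :
        A'.le a b := by
      simpa using hf' (f a) (f b) ⟨hab.le, h2⟩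
    refine ⟨mono y x h, fun hA => ?_⟩
    by_contra! h2
    have := A'.antisymm hA (mono x y h.symm h2.le)
    exact h2.ne (by rw [this])
  have hcard : position (fun x => (f x).1.1) x =
      (Finset.Ioc (rowLength (boxes Y) (f x).1.1) (f x).1.2).card := by
    refine Finset.card_bij (fun y _ => (f y).1.2) ?_ ?_ ?_
    · intro y hy
      simp only [Finset.mem_filter, Finset.mem_univ, true_and] at hy
      rw [Finset.mem_Ioc]
      have := (hS (f y)).2.2
      rw [hy.1] at this
      exact ⟨this, (key y hy.1).2 hy.2⟩
    · intro y hy z hz h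
      simp only [Finset.mem_filter, Finset.mem_univ, true_and] at hy hz
      exact f.injective (Subtype.ext (Prod.ext (hy.1.trans hz.1.symm) h))
    · intro d hd
      rw [Finset.mem_Ioc] at hd
      have h1 := hS (f x)
      have hmem : ((f x).1.1, d) ∈ skewBoxes Z Y := by
        refine mem_skewBoxes.2 ⟨mem_boxes_of_le (mem_skewBoxes.1 (f x).2).1
          ⟨le_rfl, hd.2⟩ h1.1 (by dsimp only; omega), fun h => ?_⟩
        exact hd.1.not_ge ((mem_boxes_iff_le_rowLength h1.1 (by omega)).1 h)
      refine ⟨f.symm ⟨_, hmem⟩, ?_, by simp⟩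
      have := key (f.symm ⟨_, hmem⟩) (by simp)
      simp only [Equiv.apply_symm_apply] at this
      simpa using this.1 hd.2
  rw [hcard, Nat.card_Ioc]
  have := (hS (f x)).2.2
  omega

end Bijection

/-! ### Readings of tableaux and growing Young diagrams -/

section Reading

variable {W : Finset Box} (A : AdmissibleOrder W)

theorem AdmissibleOrder.mem_boxList (x : W) : x ∈ A.boxList := by
  have := A.isLinearOrder
  let _ : DecidableRel A.le := Classical.decRel _
  exact (Finset.mem_sort A.le).2 (Finset.mem_univ x)

theorem AdmissibleOrder.pairwise_boxList :
    A.boxList.Pairwise fun x y => A.le x y ∧ x ≠ y := by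
  have := A.isLinearOrder
  let _ : DecidableRel A.le := Classical.decRel _
  exact (Finset.pairwise_sort Finset.univ A.le).and (Finset.sort_nodup Finset.univ A.le)

theorem AdmissibleOrder.mem_of_prefix {L : List W} {x : W} (h : L ++ [x] <+: A.boxList)
    (y : W) : y ∈ L ↔ A.le y x ∧ y ≠ x := by
  obtain ⟨R, hR⟩ := h
  have hp := A.pairwise_boxList
  have hm := A.mem_boxList y
  rw [← hR, List.append_assoc, List.singleton_append] at hp hm
  rw [List.pairwise_append, List.pairwise_cons] at hp
  refine ⟨fun hy => hp.2.2 y hy x (by simp), fun hy => ?_⟩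
  rcases List.mem_append.1 hm with h | h
  · exact h
  · rcases List.mem_cons.1 h with h | h
    · exact absurd h hy.2
    · exact absurd (A.antisymm hy.1 (hp.2.1.1 y h).1) hy.2

/-- The box that a tableau `T` assigns to the box `x`: in row `T x`, placed to the right of `Y` in
the position of `x` among the boxes with the same entry, counted from the right. -/
def targetBox (Y : YoungDiagram) (T : W → ℕ) (x : W) : Box :=
  (T x, rowLength (boxes Y) (T x) + position T x)

variable {Y : YoungDiagram} {T : W → ℕ}

theorem targetBox_notMem (hT1 : ∀ x, 1 ≤ T x) (x : W) : targetBox Y T x ∉ boxes Y := by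
  have := position_pos T x
  rw [targetBox, mem_boxes_iff_le_rowLength (hT1 x) (by omega)]
  omega

theorem IsSemistandard.targetBox_injective (hT : IsSemistandard T) :
    Function.Injective (targetBox Y T) := by
  intro x y h
  obtain ⟨h1, h2⟩ := Prod.ext_iff.1 h
  dsimp only [targetBox] at h1 h2
  rw [h1] at h2
  refine hT.eq_of_col_eq h1 ?_
  by_contra hne
  rcases Nat.lt_or_gt_of_ne hne with hlt | hlt
  · have := position_lt h1 hlt
    omega
  · have := position_lt h1.symm hlt
    omega

/-- Reading a semistandard tableau in an admissible order, the box added at the step of `x` is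
`targetBox Y T x`, because equal entries are read from right to left. -/
theorem addBoxes_map_of_prefix (hT : IsSemistandard T) (hW : (W : Set Box).OrdConnected)
    (hT1 : ∀ x, 1 ≤ T x) (L : List W) (hL : L <+: A.boxList) :
    addBoxes (boxes Y) (L.map T) = boxes Y ∪ L.toFinset.image (targetBox Y T) := by
  induction L using List.reverseRecOn with
  | nil => simp [addBoxes]
  | append_singleton L x ih =>
  have hmem := A.mem_of_prefix hL
  have ih' := ih ((List.prefix_append L [x]).trans hL)
  have hpos : position T x = (L.toFinset.filter fun y => T y = T x).card + 1 := by
    have hx : x ∉ L.toFinset.filter fun y => T y = T x := by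
      simp [hmem]
    rw [← Finset.card_insert_of_notMem hx, position]
    congr 1
    ext y
    simp only [Finset.mem_filter, Finset.mem_univ, true_and, Finset.mem_insert,
      List.mem_toFinset, hmem]
    constructor
    · rintro ⟨h1, h2⟩
      by_cases hyx : y = x
      · exact Or.inl hyx
      · exact Or.inr ⟨⟨(hT.le_iff_of_eq hW A h1).2 h2, hyx⟩, h1⟩
    · rintro (rfl | ⟨⟨h1, -⟩, h2⟩)
      · exact ⟨rfl, le_rfl⟩
      · exact ⟨h2, (hT.le_iff_of_eq hW A h2).1 h1⟩
  have hrow : rowLength (boxes Y ∪ L.toFinset.image (targetBox Y T)) (T x) =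
      rowLength (boxes Y) (T x) + (L.toFinset.filter fun y => T y = T x).card := by
    rw [rowLength, Finset.filter_union, Finset.card_union_of_disjoint, Finset.filter_image,
      Finset.card_image_of_injective _ hT.targetBox_injective]
    · rfl
    · refine Finset.disjoint_filter_filter (Finset.disjoint_right.2 fun b hb => ?_)
      obtain ⟨y, -, rfl⟩ := Finset.mem_image.1 hb
      exact targetBox_notMem hT1 y
  have hstep : addBoxes (boxes Y) ((L ++ [x]).map T) =
      addBox (addBoxes (boxes Y) (L.map T)) (T x) := by
    simp [addBoxes]
  have hx : [x].toFinset.image (targetBox Y T) = {targetBox Y T x} := by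
    rw [List.toFinset_cons, List.toFinset_nil, insert_empty_eq, Finset.image_singleton]
  rw [hstep, ih', addBox, hrow, add_assoc, ← hpos, List.toFinset_append, Finset.image_union, hx,
    ← Finset.union_assoc, Finset.union_comm _ {targetBox Y T x}, ← Finset.insert_eq]
  rfl

/-- The Littlewood–Richardson condition in terms of the target boxes; here `D` runs over the initial
segments of `A`. -/
theorem mem_lrTableaux_iff {r : ℕ} {Z : YoungDiagram} (hW : (W : Set Box).OrdConnected)
    (hT : T ∈ tableaux r W) :
    T ∈ lrTableaux r W Y Z A ↔
      (∀ (D : Finset W) (x : W), (∀ y, y ∈ D ↔ A.le y x) →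
        IsYoung (boxes Y ∪ D.image (targetBox Y T))) ∧
      boxes Y ∪ Finset.univ.image (targetBox Y T) = boxes Z := by
  have hT1 (x : W) : 1 ≤ T x := (hT.2 x).1
  have huniv : A.boxList.toFinset = Finset.univ := by
    ext x
    simp [A.mem_boxList]
  have hall : addBoxes (boxes Y) (reading A T) =
      boxes Y ∪ Finset.univ.image (targetBox Y T) := by
    rw [reading, addBoxes_map_of_prefix A hT.1 hW hT1 _ (List.prefix_refl _), huniv]
  have hdown (L : List W) (x : W) (h : L ++ [x] <+: A.boxList) (y : W) :
      y ∈ (L ++ [x]).toFinset ↔ A.le y x := by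
    simp only [List.mem_toFinset, List.mem_append, List.mem_singleton, A.mem_of_prefix h]
    by_cases hyx : y = x
    · simp [hyx, A.refl]
    · simp [hyx]
  rw [lrTableaux, Set.mem_ofPred_eq, hall, and_iff_right hT]
  refine and_congr_left fun _ => ⟨fun h D x hD => ?_, fun h k hk1 hk2 => ?_⟩
  · obtain ⟨L, R, hLR⟩ := List.append_of_mem (A.mem_boxList x)
    have hp : L ++ [x] <+: A.boxList := ⟨R, by simp [hLR]⟩
    have hlen := hp.length_le
    have hk := h (L ++ [x]).length (by simp) (by simpa [reading] using hlen)
    rw [reading, ← List.map_take, ← List.prefix_iff_eq_take.1 hp,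
      addBoxes_map_of_prefix A hT.1 hW hT1 _ hp] at hk
    have : D = (L ++ [x]).toFinset := by
      ext y
      rw [hD, hdown L x hp]
    rwa [this]
  · have hp := List.take_prefix k A.boxList
    rw [reading, ← List.map_take, addBoxes_map_of_prefix A hT.1 hW hT1 _ hp]
    rcases List.eq_nil_or_concat (A.boxList.take k) with hnil | ⟨L, x, hLx⟩
    · have := congrArg List.length hnil
      simp only [reading, List.length_map] at hk2
      simp only [List.length_take, List.length_nil] at this
      omega
    · rw [List.concat_eq_append] at hLx
      rw [hLx] at hp ⊢
      exact h _ x (hdown L x hp)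

end Reading

/-! ### The two maps -/

section Maps

variable {r : ℕ} {Y Z : YoungDiagram} {W : Finset Box} {A : AdmissibleOrder (skewBoxes Z Y)}
  {A' : AdmissibleOrder W}

/-- The target boxes of the tableau of rows of a picture are the images under the picture. -/
theorem targetBox_of_mem_pictures (hW : (W : Set Box).OrdConnected)
    {f : W ≃ skewBoxes Z Y} (hf : f ∈ pictures W (skewBoxes Z Y) A A') (x : W) :
    targetBox Y (fun x => (f x).1.1) x = (f x).1 :=
  Prod.ext rfl (col_eq_of_isStandard_symm hW hf.2
    (isSemistandard_of_isStandard hW (ordConnected_skewBoxes Z Y) hf.1 hf.2) x).symm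

/-- The rows of a picture form a Littlewood–Richardson tableau: `f⁻¹` being standard makes the images
of an initial segment of `A'`, together with `Y`, a Young diagram. -/
theorem rows_mem_lrTableaux (hZ : Z.colLen 0 ≤ r) (hW : (W : Set Box).OrdConnected)
    (hcard : Y.card + W.card = Z.card) {f : W ≃ skewBoxes Z Y}
    (hf : f ∈ pictures W (skewBoxes Z Y) A A') :
    (fun x => (f x).1.1) ∈ lrTableaux r W Y Z A' := by
  have hfZ (x : W) : (f x).1 ∈ boxes Z := (mem_skewBoxes.1 (f x).2).1
  have hT : (fun x => (f x).1.1) ∈ tableaux r W := by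
    refine ⟨isSemistandard_of_isStandard hW (ordConnected_skewBoxes Z Y) hf.1 hf.2,
      fun x => ⟨(one_le_of_mem_boxes (hfZ x)).1, ?_⟩⟩
    have h := mem_boxes.1 (hfZ x)
    have := YoungDiagram.mem_iff_lt_colLen.1 (Z.up_left_mem le_rfl (Nat.zero_le _) h.2.2)
    dsimp only
    omega
  have himage (D : Finset W) : D.image (targetBox Y fun x => (f x).1.1) =
      D.image fun x => (f x).1 :=
    Finset.image_congr fun x _ => targetBox_of_mem_pictures hW hf x
  -- By the count of boxes, `Z / Y` has `|Z| - |Y|` boxes, whence `Y ⊆ Z`.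
  have hYZ : boxes Y ⊆ boxes Z := by
    have h1 : (boxes Z \ boxes Y).card = W.card := by
      have := Fintype.card_congr f
      rw [Fintype.card_coe, Fintype.card_coe] at this
      exact this.symm
    have h2 := Finset.card_sdiff (s := boxes Y) (t := boxes Z)
    have h3 := Finset.card_le_card (Finset.inter_subset_right (s₁ := boxes Y) (s₂ := boxes Z))
    rw [card_boxes] at h2 h3
    have h4 : boxes Y ∩ boxes Z = boxes Y :=
      Finset.eq_of_subset_of_card_le Finset.inter_subset_left (by rw [card_boxes]; omega)
    exact Finset.inter_eq_left.1 h4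
  rw [mem_lrTableaux_iff A' hW hT]
  refine ⟨fun D x hD => ?_, ?_⟩
  · rw [himage, isYoung_iff]
    refine ⟨fun b hb => ?_, fun a b hb hab h1 h2 => ?_⟩
    · rcases Finset.mem_union.1 hb with hb | hb
      · exact one_le_of_mem_boxes hb
      · obtain ⟨y, -, rfl⟩ := Finset.mem_image.1 hb
        exact one_le_of_mem_boxes (hfZ y)
    · by_cases haY : a ∈ boxes Y
      · exact Finset.mem_union_left _ haY
      rcases Finset.mem_union.1 hb with hb | hb
      · exact absurd (mem_boxes_of_le hb hab h1 h2) haY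
      · obtain ⟨y, hy, rfl⟩ := Finset.mem_image.1 hb
        have ha : a ∈ skewBoxes Z Y := mem_skewBoxes.2 ⟨mem_boxes_of_le (hfZ y) hab h1 h2, haY⟩
        have h := hf.2 ⟨a, ha⟩ (f y) hab
        rw [f.symm_apply_apply] at h
        exact Finset.mem_union_right _ (Finset.mem_image.2
          ⟨f.symm ⟨a, ha⟩, (hD _).2 (A'.trans h ((hD y).1 hy)), by simp⟩)
  · rw [himage]
    refine Finset.Subset.antisymm (Finset.union_subset hYZ fun b hb => ?_) fun b hb => ?_
    · obtain ⟨y, -, rfl⟩ := Finset.mem_image.1 hb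
      exact hfZ y
    · by_cases hbY : b ∈ boxes Y
      · exact Finset.mem_union_left _ hbY
      · exact Finset.mem_union_right _ (Finset.mem_image.2
          ⟨f.symm ⟨b, mem_skewBoxes.2 ⟨hb, hbY⟩⟩, Finset.mem_univ _, by simp⟩)

/-- The target boxes of a Littlewood–Richardson tableau define a picture: the intermediate diagrams
being Young diagrams says that the inverse is standard. -/
theorem exists_picture_of_mem_lrTableaux (hW : (W : Set Box).OrdConnected)
    (A : AdmissibleOrder (skewBoxes Z Y)) {T : W → ℕ} (hT : T ∈ lrTableaux r W Y Z A') :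
    ∃ f ∈ pictures W (skewBoxes Z Y) A A', ∀ x, (f x).1 = targetBox Y T x := by
  classical
  have hT0 : T ∈ tableaux r W := hT.1
  have hT1 (x : W) : 1 ≤ T x := (hT0.2 x).1
  obtain ⟨hyoung, hall⟩ := (mem_lrTableaux_iff A' hW hT0).1 hT
  have hmem (x : W) : targetBox Y T x ∈ skewBoxes Z Y := by
    refine mem_skewBoxes.2 ⟨?_, targetBox_notMem hT1 x⟩
    rw [← hall]
    exact Finset.mem_union_right _ (Finset.mem_image_of_mem _ (Finset.mem_univ x))
  have hinj := hT0.1.targetBox_injective (Y := Y)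
  have hbij : Function.Bijective fun x : W => (⟨targetBox Y T x, hmem x⟩ : skewBoxes Z Y) := by
    refine ⟨fun x y h => hinj (congrArg Subtype.val h), fun ⟨b, hb⟩ => ?_⟩
    obtain ⟨hbZ, hbY⟩ := mem_skewBoxes.1 hb
    rw [← hall, Finset.mem_union, or_iff_right hbY] at hbZ
    obtain ⟨x, -, rfl⟩ := Finset.mem_image.1 hbZ
    exact ⟨x, rfl⟩
  set f : W ≃ skewBoxes Z Y := Equiv.ofBijective _ hbij
  have hfx (x : W) : (f x).1 = targetBox Y T x := rfl
  have hf' : IsStandard A' f.symm := by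
    intro u v huv
    obtain ⟨x, rfl⟩ := f.surjective u
    obtain ⟨y, rfl⟩ := f.surjective v
    rw [f.symm_apply_apply, f.symm_apply_apply]
    have h := isYoung_iff.1 (hyoung (Finset.univ.filter fun w => A'.le w y) y (by simp))
    have h1 := one_le_of_mem_boxes (mem_skewBoxes.1 (f x).2).1
    have h2 := h.2 (f x).1 (f y).1 (Finset.mem_union_right _ (Finset.mem_image.2
      ⟨y, by simp [A'.refl], rfl⟩)) huv h1.1 h1.2
    rw [Finset.mem_union, or_iff_right (mem_skewBoxes.1 (f x).2).2] at h2
    obtain ⟨w, hw, hwx⟩ := Finset.mem_image.1 h2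
    rw [hfx] at hwx
    rw [← hinj hwx]
    exact (Finset.mem_filter.1 hw).2
  exact ⟨f, ⟨isStandard_of_isSemistandard hW (ordConnected_skewBoxes Z Y) hf' hT0.1 A, hf'⟩, hfx⟩

end Maps

end LRPictures

theorem theorem2p4 (r : ℕ) (Y Z : YoungDiagram) (hY : Y.colLen 0 ≤ r) (hZ : Z.colLen 0 ≤ r)
    (W : Finset LRPictures.Box) (hW : LRPictures.IsSkewDiagram W)
    (hcard : Y.card + W.card = Z.card)
    (A : LRPictures.AdmissibleOrder (LRPictures.skewBoxes Z Y))
    (A' : LRPictures.AdmissibleOrder W) :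
    ∃ Φ : LRPictures.pictures W (LRPictures.skewBoxes Z Y) A A' ≃
        LRPictures.lrTableaux r W Y Z A',
      (∀ (f : LRPictures.pictures W (LRPictures.skewBoxes Z Y) A A') (x : W),
        (Φ f).1 x = (f.1 x).1.1) ∧
      (∀ (T : LRPictures.lrTableaux r W Y Z A') (x : W),
        ((Φ.symm T).1 x).1 =
          (T.1 x, LRPictures.rowLength (LRPictures.boxes Y) (T.1 x) +
            LRPictures.position T.1 x)) := by
  have hW' := hW.ordConnected
  choose g hg hgT using fun T : LRPictures.lrTableaux r W Y Z A' =>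
    LRPictures.exists_picture_of_mem_lrTableaux hW' A T.2
  refine ⟨⟨fun f => ⟨_, LRPictures.rows_mem_lrTableaux hZ hW' hcard f.2⟩,
    fun T => ⟨g T, hg T⟩, fun f => ?_, fun T => ?_⟩, fun f x => rfl, hgT⟩
  · refine Subtype.ext (Equiv.ext fun x => Subtype.ext ?_)
    exact (hgT _ x).trans (LRPictures.targetBox_of_mem_pictures hW' f.2 x)
  · exact Subtype.ext (funext fun x => congrArg Prod.fst (hgT T x))
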